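/- Let $q$ be an odd prime power, let $G=\mathrm{PSL}(2,q)$, let $m$ be a squarefree positive integer with $q\equiv 1$ or $q\equiv -1 \pmod{2m}$, and let $(\mathrm{pa}_d)_{d\mid m}$ be a distribution of virtual partial augmentations of order $m$ for $G$ (defined below). Then $G$ has an element $g_0$ of order $m$ such that, for every prime divisor $t$ of $m$ and every $g\in G$, $$\mathrm{pa}_{m/t}(g)=\begin{cases}1,&\text{if } g \text{ is conjugate in } G \text{ to } g_0^{m/t};\\ 0,&\text{otherwise.}\end{cases}$$ Here, for a finite group $G$ and a positive integer $n$, with $\zeta_n$ a complex primitive $n$-th root of unity and $\sum_{x^G}$ denoting a sum over representatives $x$ of the conjugacy classes of $G$, a *distribution of virtual partial augmentations* of order $n$ for $G$ is a list $\mathrm{pa}=(\mathrm{pa}_d)_{d\mid n}$ of $\mathbb Z$-valued class functions of $G$, indexed by the positive divisors $d$ of $n$, such that: * (V1) $\sum_{x^G}\mathrm{pa}_d(x)=1$ for every $d\mid n$; * (V2) $\mathrm{pa}_d(1)=0$ for every $d\mid n$ with $d\neq n$; * (V3) $\mathrm{pa}_d(x)=0$ whenever $d\mid n$ and the order of $x$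 does not divide $n/d$; * (V4) if $\chi$ is either an ordinary (complex) character of $G$ or a Brauer character of $G$ modulo a prime not dividing $n$, and $l\in\mathbb Z$, then $$\frac1n\sum_{x^G}\sum_{d\mid n}\mathrm{pa}_d(x)\,\mathrm{Tr}_{\mathbb Q(\zeta_n^d)/\mathbb Q}\bigl(\chi(x)\zeta_n^{-ld}\bigr)\in\mathbb Z_{\ge 0}.$$ In (V4) the terms with $\mathrm{pa}_d(x)=0$ are read as $0$; in the other terms $x$ has order dividing $n/d$ by (V3), so that $\chi(x)$ is defined and lies in $\mathbb Q(\zeta_n^d)$. -/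

import Mathlib

open scoped MatrixGroups

noncomputable section

namespace HeLP

/-- The complex primitive `n`-th root of unity `exp (2 π i / n)`. -/
def zeta (n : ℕ) : ℂ := Complex.exp (2 * Real.pi * Complex.I / n)

/-- The trace of `ℚ(ζ) / ℚ`, evaluated at a complex number `z` of `ℚ(ζ)`
(and, by convention, `0` if `z` is not in `ℚ(ζ)`). -/
def cycTrace (ζ z : ℂ) : ℚ :=
  open Classical in
  if h : z ∈ IntermediateField.adjoin ℚ {ζ} then
    Algebra.trace ℚ (IntermediateField.adjoin ℚ {ζ}) ⟨z, h⟩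
  else 0

variable {G : Type*} [Group G]

/-- The sum of the values of `f` over a set of representatives of the conjugacy classes of the
finite group `G`. -/
def classSum {M : Type*} [AddCommMonoid M] (f : G → M) : M :=
  ∑ᶠ c : ConjClasses G, f (Quotient.out (s := IsConj.setoid G) c)

/-- `f` is constant on conjugacy classes. -/
def IsClassFunction {M : Type*} (f : G → M) : Prop :=
  ∀ g h : G, IsConj g h → f g = f h

/-- `χ` is the character of a finite-dimensional complex representation of `G`. -/
def IsOrdinaryCharacter (χ : G → ℂ) : Prop :=
  ∃ (k : ℕ) (ρ : Representation ℂ G (Fin k → ℂ)), ∀ g, χ g = ρ.character g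

/-- The largest divisor of `|G|` that is prime to the prime `p`; the order of each `p`-regular
element of the finite group `G` divides it. -/
def regularPart (G : Type*) (p : ℕ) : ℕ :=
  Nat.card G / p ^ (Nat.card G).factorization p

/-- For an isomorphism `θ` from the `N`-th roots of unity of `K` to those of `ℂ`, the complex
number that `θ` attaches to an element `z` of `K` with `z ^ N = 1` (and `0` for other `z`). -/
def liftRoot {K : Type*} [Field K] {N : ℕ} (θ : rootsOfUnity N K ≃* rootsOfUnity N ℂ)
    (z : K) : ℂ :=
  open Classical in
  if h : ∃ u : rootsOfUnity N K, ((u : Kˣ) : K) = z then ((θ h.choose : ℂˣ) : ℂ) else 0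

/-- `χ` is a Brauer character of `G` modulo the prime `p`: there are an identification `θ` of the
roots of unity of order dividing the `p'`-part of `|G|` in an algebraic closure of the field with
`p` elements with the complex ones, and a representation `ρ` of `G` over that algebraic closure,
such that, for each `p`-regular `g`, the value `χ g` is the sum of the complex lifts of the
eigenvalues of `ρ g`, counted with multiplicity.

A Brauer character is a function on the `p`-regular elements only; it is represented here by its
extension by zero. -/
def IsBrauerCharacter (p : ℕ) [Fact p.Prime] (χ : G → ℂ) : Prop :=
  ∃ (θ : rootsOfUnity (regularPart G p) (AlgebraicClosure (ZMod p)) ≃*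
        rootsOfUnity (regularPart G p) ℂ)
    (k : ℕ) (ρ : Representation (AlgebraicClosure (ZMod p)) G
        (Fin k → AlgebraicClosure (ZMod p))),
    (∀ g : G, ¬ p ∣ orderOf g → χ g = ((ρ g).charpoly.roots.map (liftRoot θ)).sum) ∧
    ∀ g : G, p ∣ orderOf g → χ g = 0

/-- The number `μ(ζ_n ^ l, pa, χ)`, that is,
`(1/n) ∑_{x^G} ∑_{d ∣ n} pa_d(x) Tr_{ℚ(ζ_n ^ d)/ℚ} (χ(x) ζ_n ^ (-l d))`.

When `pa_d(x) = 0` for all `x` with `|x| ∤ n / d`, and `χ` is an ordinary character or a Brauer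
character modulo a prime not dividing `n`, the values of `χ x` outside `ℚ(ζ_n ^ d)`, and those at
elements `x` where a Brauer character is not defined, occur only with the factor `0`. -/
def mult (n : ℕ) (pa : ℕ → G → ℤ) (χ : G → ℂ) (l : ℤ) : ℚ :=
  (1 / (n : ℚ)) * classSum fun x : G =>
    ∑ d ∈ n.divisors, (pa d x : ℚ) * cycTrace (zeta n ^ d) (χ x * zeta n ^ (-(l * (d : ℤ))))

/-- `pa` is a distribution of virtual partial augmentations of order `n` for the finite group `G`.
Only the components `pa d` with `d ∣ n` matter. -/
structure IsVPA (n : ℕ) (pa : ℕ → G → ℤ) : Prop where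
  classFunction : ∀ d ∈ n.divisors, IsClassFunction (pa d)
  v1 : ∀ d ∈ n.divisors, classSum (pa d) = 1
  v2 : ∀ d ∈ n.divisors, d ≠ n → pa d 1 = 0
  v3 : ∀ d ∈ n.divisors, ∀ x : G, ¬ orderOf x ∣ n / d → pa d x = 0
  v4_ordinary : ∀ χ : G → ℂ, IsOrdinaryCharacter χ →
    ∀ l : ℤ, ∃ k : ℕ, mult n pa χ l = k
  v4_brauer : ∀ (p : ℕ) [Fact p.Prime], ¬ p ∣ n → ∀ χ : G → ℂ, IsBrauerCharacter p χ →
    ∀ l : ℤ, ∃ k : ℕ, mult n pa χ l = k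

end HeLP

end

/-!
The characteristic `p` of `F` divides neither `2` nor `m`, and the symmetric square of the natural
module of `SL(2, F)` is a representation of `PSL(2, F)` over an algebraic closure `K` of the prime
field. If the eigenvalues of a matrix representing `x` have ratio `ω`, then `x` acts on it with
eigenvalues `1, ω, ω⁻¹` (`HeLP.roots_charpoly_symSqRep`). The ratio, up to inversion, determines the
class of `x` when `ω ≠ 1` (`HeLP.IsEigenRatio.isConj`), and it has the same order as `x` when that
order is prime to `p` (`HeLP.IsEigenRatio.pow_eq_one_iff`).

Let `χ` be the Brauer character of this representation and let `t` be a prime divisor of `m`. Adding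
up the multiplicities `mult m pa χ l'` over the residues `l'` modulo `m` that are congruent to `l`
modulo `t` removes all components of `pa` except those at `m / t` and `m` (`HeLP.sum_mult_eq`), so
the problem reduces to elements of the prime order `t`. Since a nontrivial `t`-th root of unity has
trace `-1`, the multiplicity of a nontrivial `t`-th root of unity `ξ` is, up to a positive factor,
the value of `pa (m / t)` on the class of elements of order `t` with lifted ratio `ξ` or `ξ⁻¹`.
Thus all values of `pa (m / t)` are nonnegative, and as they sum to `1` over the classes, exactly
one class carries the value `1` (`HeLP.IsVPA.exists_isConj_iff`).

Finally `PSL(2, F)` has an element `h` of order `m`, which has a primitive `m`-th root of unity as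
its ratio (`HeLP.exists_orderOf_eq_and_isEigenRatio`). Hence the class found for `t` contains a
power of `h ^ (m / t)` with exponent prime to `t`, and the Chinese remainder theorem combines these
exponents into a single `b` for which `h ^ b` serves all `t` at once.
-/

namespace HeLP

section Matrices

open Matrix Polynomial

/-! ### Conjugacy in `SL(2, F)` -/

lemma exists_sq_sub_mul_sq {F : Type*} [Field F] [Finite F] (hF : Odd (Nat.card F)) {D : F}
    (hD : D ≠ 0) (e : F) : ∃ u v : F, u ^ 2 - D * v ^ 2 = e := by
  have := Fintype.ofFinite F
  have hf : (X ^ 2 - C e : F[X]).degree = 2 := degree_X_pow_sub_C (by norm_num) e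
  have hg : (C (-D) * X ^ 2 : F[X]).degree = 2 := degree_C_mul_X_pow 2 (neg_ne_zero.2 hD)
  obtain ⟨u, v, h⟩ := FiniteField.exists_root_sum_quadratic hf hg
    (by rw [← Nat.card_eq_fintype_card]; exact Nat.odd_iff.1 hF)
  refine ⟨u, v, ?_⟩
  simp only [eval_sub, eval_pow, eval_X, eval_C, eval_mul] at h
  linear_combination h

lemma two_ne_zero_of_odd_card {F : Type*} [Field F] [Finite F] (hF : Odd (Nat.card F)) :
    (2 : F) ≠ 0 := by
  have := Fintype.ofFinite F
  apply Ring.two_ne_zero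
  rw [Ne, FiniteField.even_card_iff_char_two, ← Nat.card_eq_fintype_card]
  rcases hF with ⟨k, hk⟩
  omega

/-- A binary quadratic form of nonzero discriminant over a finite field of odd order
represents `1`. -/
lemma exists_binary_form_eq_one {F : Type*} [Field F] [Finite F] (hF : Odd (Nat.card F))
    (α β γ : F) (hD : β ^ 2 - 4 * α * γ ≠ 0) :
    ∃ x y : F, α * x ^ 2 + β * x * y + γ * y ^ 2 = 1 := by
  have h2 := two_ne_zero_of_odd_card hF
  by_cases hα : α = 0
  · subst hα
    have hβ : β ≠ 0 := by rintro rfl; simp at hD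
    exact ⟨(1 - γ) / β, 1, by field_simp; ring⟩
  · obtain ⟨u, v, h⟩ := exists_sq_sub_mul_sq hF hD (4 * α)
    refine ⟨(u - β * v) / (2 * α), v, ?_⟩
    field_simp
    linear_combination h

/-- The companion matrix of `X ^ 2 - τ X + 1`. -/
def companion {F : Type*} [Field F] (τ : F) : SL(2, F) :=
  ⟨!![0, -1; 1, τ], by simp [det_fin_two]⟩

/-- In a basis `v, A v` of determinant `1` the matrix `A` becomes the companion matrix of its
characteristic polynomial; such `v` are the solutions of a binary quadratic equation. -/
lemma isConj_companion {F : Type*} [Field F] [Finite F] (hF : Odd (Nat.card F)) (A : SL(2, F))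
    (hA : A.1.trace ^ 2 ≠ 4) : IsConj (companion A.1.trace) A := by
  have hdet := A.2
  rw [det_fin_two] at hdet
  rw [trace_fin_two] at hA ⊢
  obtain ⟨x, y, h⟩ := exists_binary_form_eq_one hF (A.1 1 0) (A.1 1 1 - A.1 0 0) (-A.1 0 1)
    (fun h => hA (by linear_combination h + 4 * hdet))
  let P : SL(2, F) := ⟨!![x, A.1 0 0 * x + A.1 0 1 * y; y, A.1 1 0 * x + A.1 1 1 * y], by
    rw [det_fin_two_of]; linear_combination h⟩
  rw [isConj_iff]
  refine ⟨P, mul_inv_eq_iff_eq_mul.2 (Subtype.ext ?_)⟩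
  rw [Matrix.SpecialLinearGroup.coe_mul, Matrix.SpecialLinearGroup.coe_mul]
  ext i j
  fin_cases i <;> fin_cases j <;>
    simp [P, companion, mul_apply, Fin.sum_univ_two]
  · linear_combination x * hdet
  · linear_combination y * hdet

lemma isConj_of_trace_eq {F : Type*} [Field F] [Finite F] (hF : Odd (Nat.card F)) {A B : SL(2, F)}
    (hA : A.1.trace ^ 2 ≠ 4) (h : A.1.trace = B.1.trace) : IsConj A B :=
  (isConj_companion hF A hA).symm.trans (h ▸ isConj_companion hF B (h ▸ hA))

/-! ### The symmetric square -/

/-- The symmetric square of a `2 × 2` matrix, on the basis of monomials of degree two. -/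
def symSq {R : Type*} [CommRing R] (M : Matrix (Fin 2) (Fin 2) R) : Matrix (Fin 3) (Fin 3) R :=
  !![M 0 0 ^ 2, M 0 0 * M 0 1, M 0 1 ^ 2;
    2 * (M 0 0 * M 1 0), M 0 0 * M 1 1 + M 0 1 * M 1 0, 2 * (M 0 1 * M 1 1);
    M 1 0 ^ 2, M 1 0 * M 1 1, M 1 1 ^ 2]

lemma symSq_mul {R : Type*} [CommRing R] (M N : Matrix (Fin 2) (Fin 2) R) :
    symSq (M * N) = symSq M * symSq N := by
  ext i j
  fin_cases i <;> fin_cases j <;>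
    simp [symSq, mul_apply, Fin.sum_univ_two, Fin.sum_univ_three] <;> ring

lemma symSq_scalar {R : Type*} [CommRing R] (r : R) (hr : r ^ 2 = 1) :
    symSq (scalar (Fin 2) r) = 1 := by
  ext i j
  fin_cases i <;> fin_cases j <;> simp [symSq, hr, ← pow_two]

lemma det_scalar_sub_symSq {R : Type*} [CommRing R] (M : Matrix (Fin 2) (Fin 2) R) (t : R) :
    (scalar (Fin 3) t - symSq M).det =
      (t - M.det) * (t ^ 2 - (M.trace ^ 2 - 2 * M.det) * t + M.det ^ 2) := by
  rw [det_fin_three, det_fin_two, trace_fin_two]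
  simp [symSq]
  ring

section Ratio

variable {F K : Type*} [Field F] [Field K] (φ : F →+* K)

/-- The symmetric square, over an extension `K` of `F`, as a representation of `PSL(2, F)`. -/
def symSqRep : Representation K (PSL(2, F)) (Fin 3 → K) :=
  QuotientGroup.lift (Subgroup.center SL(2, F))
    { toFun := fun A => toLinAlgEquiv' (symSq (A.1.map φ))
      map_one' := by
        have : symSq (1 : Matrix (Fin 2) (Fin 2) K) = 1 := by
          simpa using symSq_scalar (1 : K) (one_pow 2)
        simp [this]
      map_mul' := fun A B => by
        simp [symSq_mul, Matrix.map_mul] }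
    (by
      intro A hA
      obtain ⟨r, hr, hA⟩ := Matrix.SpecialLinearGroup.mem_center_iff.1 hA
      have : A.1.map φ = scalar (Fin 2) (φ r) := by
        rw [← hA]; ext i j; fin_cases i <;> fin_cases j <;> simp
      rw [MonoidHom.mem_ker]
      simp only [MonoidHom.coe_mk, OneHom.coe_mk, this]
      rw [symSq_scalar _ (by rw [← map_pow]; simpa using congrArg φ hr), map_one])

/-! ### Eigenvalue ratios -/

/-- `ω` is a ratio of the two eigenvalues of a matrix that represents `x`. The eigenvalues are
mutually inverse with sum the trace, so their ratio `ω` is determined up to inversion by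
`ω + 2 + ω⁻¹ = trace ^ 2`. -/
def IsEigenRatio (x : PSL(2, F)) (ω : K) : Prop :=
  ω ≠ 0 ∧ ∃ A : SL(2, F), (A : PSL(2, F)) = x ∧ φ A.1.trace ^ 2 = ω + 2 + ω⁻¹

/-- If the matrix has eigenvalues `l` and `l⁻¹`, with ratio `ω = l ^ 2`, then its symmetric square
has the eigenvalues `l ^ 2`, `1` and `l ^ (-2)`. -/
lemma roots_charpoly_symSqRep {x : PSL(2, F)} {ω : K} [Infinite K] (h : IsEigenRatio φ x ω) :
    (symSqRep φ x).charpoly.roots = {1, ω, ω⁻¹} := by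
  obtain ⟨h0, A, rfl, hA⟩ := h
  have e : symSqRep φ (A : PSL(2, F)) = toLin' (symSq (A.1.map φ)) := rfl
  have hdet : (A.1.map φ).det = 1 := by
    have := congrArg φ A.2
    rwa [RingHom.map_det, map_one] at this
  have htr : (A.1.map φ).trace = φ A.1.trace := by simp [trace_fin_two]
  have : (symSqRep φ (A : PSL(2, F))).charpoly =
      (Multiset.map (fun a => X - C a) {1, ω, ω⁻¹}).prod := by
    rw [e, Matrix.charpoly_toLin']
    apply Polynomial.funext
    intro t
    rw [eval_charpoly, det_scalar_sub_symSq, hdet, htr, hA]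
    simp only [Multiset.insert_eq_cons, Multiset.map_cons, Multiset.map_singleton,
      Multiset.prod_cons, Multiset.prod_singleton, eval_mul, eval_sub, eval_X, eval_C]
    field_simp
    ring
  rw [this, roots_multiset_prod_X_sub_C]

lemma coe_eq_coe_iff_PSL {A B : SL(2, F)} :
    (A : PSL(2, F)) = (B : PSL(2, F)) ↔ A = B ∨ A = -B := by
  rw [QuotientGroup.eq, Matrix.SpecialLinearGroup.mem_center_iff]
  constructor
  · rintro ⟨r, hr, h⟩
    have hB : B.1 = A.1 * scalar (Fin 2) r := by
      rw [h, ← Matrix.SpecialLinearGroup.coe_mul, mul_inv_cancel_left]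
    have : r = 1 ∨ r = -1 := sq_eq_sq_iff_eq_or_eq_neg.1 (by simpa using hr)
    rcases this with rfl | rfl
    · left; ext i j; simp [hB]
    · right; ext i j; fin_cases i <;> fin_cases j <;> simp [hB, mul_apply, Fin.sum_univ_two]
  · rintro (rfl | rfl)
    · exact ⟨1, by simp⟩
    · refine ⟨-1, by simp, ?_⟩
      have : (-B)⁻¹ * B = -1 := by rw [inv_mul_eq_iff_eq_mul]; simp
      rw [this]; ext i j; fin_cases i <;> fin_cases j <;> simp

lemma IsEigenRatio.trace_sq {A : SL(2, F)} {ω : K} (h : IsEigenRatio φ (A : PSL(2, F)) ω) :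
    φ A.1.trace ^ 2 = ω + 2 + ω⁻¹ := by
  obtain ⟨_, B, hB, h⟩ := h
  rcases coe_eq_coe_iff_PSL.1 hB with rfl | rfl
  · exact h
  · rwa [Matrix.SpecialLinearGroup.coe_neg, trace_neg, map_neg, neg_sq] at h

lemma IsEigenRatio.inv {x : PSL(2, F)} {ω : K} (h : IsEigenRatio φ x ω) :
    IsEigenRatio φ x ω⁻¹ := by
  obtain ⟨h0, A, hA, h⟩ := h
  exact ⟨inv_ne_zero h0, A, hA, by rw [h, inv_inv]; ring⟩

/-- The ratio exists over an algebraically closed field: it is a root of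
`X ^ 2 + (2 - trace ^ 2) X + 1`. -/
lemma exists_isEigenRatio [IsAlgClosed K] (x : PSL(2, F)) : ∃ ω : K, IsEigenRatio φ x ω := by
  obtain ⟨A, rfl⟩ := QuotientGroup.mk_surjective x
  obtain ⟨ω, hω⟩ := IsAlgClosed.exists_root
    (C 1 * X ^ 2 + C (2 - φ A.1.trace ^ 2) * X + C 1 : K[X])
    (by rw [degree_quadratic one_ne_zero]; norm_num)
  have h : ω ^ 2 + (2 - φ A.1.trace ^ 2) * ω + 1 = 0 := by simpa [IsRoot] using hω
  have h0 : ω ≠ 0 := by rintro rfl; simp at h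
  refine ⟨ω, h0, A, rfl, ?_⟩
  field_simp
  linear_combination -h

/-- The trace of a power of a matrix with eigenvalues `l` and `μ`. -/
lemma trace_pow_eq {R : Type*} [CommRing R] (M : Matrix (Fin 2) (Fin 2) R) {l μ : R}
    (hl : l * μ = 1) (hdet : M.det = 1) (htr : M.trace = l + μ) (k : ℕ) :
    (M ^ k).trace = l ^ k + μ ^ k := by
  have hM : M ^ 2 = (l + μ) • M - 1 := by
    rw [det_fin_two] at hdet
    rw [← htr, trace_fin_two]
    ext i j
    fin_cases i <;> fin_cases j <;> simp [pow_two, mul_apply, Fin.sum_univ_two]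
    · linear_combination -hdet
    · ring
    · ring
    · linear_combination -hdet
  induction k using Nat.twoStepInduction with
  | zero => simp; ring
  | one => simpa using htr
  | more k h1 h2 =>
    rw [pow_add, hM, mul_sub, mul_smul_comm, ← pow_succ, trace_sub, trace_smul, mul_one, h1, h2,
      smul_eq_mul]
    linear_combination (l ^ k + μ ^ k) * hl

lemma IsEigenRatio.pow [IsAlgClosed K] {x : PSL(2, F)} {ω : K} (h : IsEigenRatio φ x ω) (k : ℕ) :
    IsEigenRatio φ (x ^ k) (ω ^ k) := by
  obtain ⟨h0, A, rfl, hA⟩ := h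
  obtain ⟨l, rfl⟩ := IsAlgClosed.exists_pow_nat_eq ω (n := 2) (by norm_num)
  have hl : l ≠ 0 := by rintro rfl; simp at h0
  have key : ∃ l' : K, l' ≠ 0 ∧ l' ^ 2 = l ^ 2 ∧ φ A.1.trace = l' + l'⁻¹ := by
    have : φ A.1.trace ^ 2 = (l + l⁻¹) ^ 2 := by rw [hA]; field_simp; ring
    rcases sq_eq_sq_iff_eq_or_eq_neg.1 this with h | h
    · exact ⟨l, hl, rfl, h⟩
    · exact ⟨-l, neg_ne_zero.2 hl, by ring, by rw [h, inv_neg]; ring⟩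
  obtain ⟨l', hl', hsq, htr⟩ := key
  rw [← hsq]
  refine ⟨pow_ne_zero _ (pow_ne_zero _ hl'), A ^ k, rfl, ?_⟩
  have hdet : (A.1.map φ).det = 1 := by
    have := congrArg φ A.2
    rwa [RingHom.map_det, map_one] at this
  have := trace_pow_eq (A.1.map φ) (mul_inv_cancel₀ hl') hdet
    (by rw [← htr]; simp [trace_fin_two]) k
  have e : φ ((A ^ k).1.trace) = ((A.1.map φ) ^ k).trace := by
    have : (A.1.map φ) ^ k = (A.1 ^ k).map φ := (map_pow φ.mapMatrix A.1 k).symm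
    rw [this]
    exact AddMonoidHom.map_trace φ.toAddMonoidHom _
  rw [e, this, inv_pow, ← pow_mul, mul_comm 2 k, pow_mul]
  have := pow_ne_zero k hl'
  field_simp
  ring

lemma eq_one_of_add_inv {ω : K} (h0 : ω ≠ 0) (h : ω + 2 + ω⁻¹ = 4) : ω = 1 := by
  have : (ω - 1) ^ 2 = 0 := by field_simp at h; linear_combination h
  exact sub_eq_zero.1 (pow_eq_zero_iff two_ne_zero |>.1 this)

lemma IsEigenRatio.eq_one {ω : K} (h : IsEigenRatio φ (1 : PSL(2, F)) ω) : ω = 1 := by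
  have := IsEigenRatio.trace_sq φ (A := 1) h
  refine eq_one_of_add_inv h.1 (this.symm.trans ?_)
  have : (1 : SL(2, F)).1.trace = 2 := by
    rw [Matrix.SpecialLinearGroup.coe_one, trace_one]; simp
  rw [this, map_ofNat]
  norm_num

/-- An element with eigenvalue ratio `1` is unipotent up to sign. -/
lemma IsEigenRatio.pow_char_eq_one (p : ℕ) [Fact p.Prime] [CharP F p] {x : PSL(2, F)}
    (h : IsEigenRatio φ x 1) : x ^ p = 1 := by
  obtain ⟨_, A, rfl, hA⟩ := h
  have h4 : A.1.trace ^ 2 = 2 ^ 2 := 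
    φ.injective (by rw [map_pow, hA, map_pow, map_ofNat]; norm_num)
  have key : ∀ B : SL(2, F), B.1.trace = 2 → B ^ p = 1 := by
    intro B hB
    have hn : (B.1 - 1) ^ 2 = 0 := by
      have hdet := B.2
      rw [det_fin_two] at hdet
      rw [trace_fin_two] at hB
      have e : B.1 1 1 = 2 - B.1 0 0 := by linear_combination hB
      rw [e] at hdet
      ext i j
      fin_cases i <;> fin_cases j <;> simp [pow_two, mul_apply, Fin.sum_univ_two, e]
      · linear_combination -hdet
      · ring
      · ring
      · linear_combination -hdet
    have hp : (B.1 - 1) ^ p = 0 := pow_eq_zero_of_le (Fact.out : p.Prime).two_le hn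
    rw [sub_pow_char_of_commute p (Commute.one_right _), one_pow, sub_eq_zero] at hp
    exact Subtype.ext (by simpa using hp)
  rcases sq_eq_sq_iff_eq_or_eq_neg.1 h4 with h | h
  · exact congrArg _ (key A h)
  · have : (A : PSL(2, F)) = ((-A : SL(2, F)) : PSL(2, F)) :=
      coe_eq_coe_iff_PSL.2 (Or.inr (neg_neg A).symm)
    rw [this]
    refine congrArg _ (key (-A) ?_)
    rw [Matrix.SpecialLinearGroup.coe_neg, trace_neg, h, neg_neg]

/-- Elements with the same ratio have, up to sign, the same trace. -/
lemma IsEigenRatio.isConj [Finite F] (hF : Odd (Nat.card F)) {x y : PSL(2, F)} {ω : K}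
    (hx : IsEigenRatio φ x ω) (hy : IsEigenRatio φ y ω) (h1 : ω ≠ 1) : IsConj x y := by
  obtain ⟨h0, A, rfl, hA⟩ := hx
  obtain ⟨_, B, rfl, hB⟩ := hy
  have hA4 : A.1.trace ^ 2 ≠ 4 := fun h => h1 (eq_one_of_add_inv h0 (by
    rw [← hA, ← map_pow, h, map_ofNat]))
  have hmap : ∀ B' : SL(2, F), A.1.trace = B'.1.trace →
      IsConj (A : PSL(2, F)) (B' : PSL(2, F)) := fun B' h =>
    (QuotientGroup.mk' (Subgroup.center SL(2, F))).map_isConj (isConj_of_trace_eq hF hA4 h)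
  have : A.1.trace ^ 2 = B.1.trace ^ 2 := φ.injective (by rw [map_pow, map_pow, hA, hB])
  rcases sq_eq_sq_iff_eq_or_eq_neg.1 this with h | h
  · exact hmap B h
  · rw [show (B : PSL(2, F)) = ((-B : SL(2, F)) : PSL(2, F)) from
      coe_eq_coe_iff_PSL.2 (Or.inr (neg_neg B).symm)]
    refine hmap (-B) ?_
    rw [Matrix.SpecialLinearGroup.coe_neg, trace_neg, h]

/-- For elements of order prime to the characteristic `p`, powers are detected by the ratio. -/
lemma IsEigenRatio.pow_eq_one_iff [IsAlgClosed K] (p : ℕ) [Fact p.Prime] [CharP F p]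
    {x : PSL(2, F)} {ω : K} (h : IsEigenRatio φ x ω) (hx : (orderOf x).Coprime p) (k : ℕ) :
    x ^ k = 1 ↔ ω ^ k = 1 := by
  have hk := h.pow φ k
  constructor
  · intro h1
    rw [h1] at hk
    exact hk.eq_one φ
  · intro h1
    rw [h1] at hk
    have h2 := orderOf_dvd_of_pow_eq_one (hk.pow_char_eq_one φ p)
    have h3 : (orderOf (x ^ k)).Coprime p := hx.coprime_dvd_left (orderOf_pow_dvd k)
    exact orderOf_eq_one_iff.1 (Nat.Coprime.eq_one_of_dvd h3 h2)

lemma mem_range_of_pow_card [Finite F] {z : K} (h : z ^ Nat.card F = z) : ∃ a, φ a = z := by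
  have := Fintype.ofFinite F
  rw [Nat.card_eq_fintype_card] at h
  have hc : 1 < Fintype.card F := Fintype.one_lt_card
  have e : (X ^ Fintype.card F - X : K[X]) = (X ^ Fintype.card F - X : F[X]).map φ := by simp
  have h2 : (X ^ Fintype.card F - X : F[X]) =
      (((X ^ Fintype.card F - X : F[X]).roots).map (fun a => X - C a)).prod := by
    refine (prod_multiset_X_sub_C_of_monic_of_roots_card_eq
      (monic_X_pow_sub (by rw [degree_X]; exact_mod_cast hc)) ?_).symm
    rw [FiniteField.roots_X_pow_card_sub_X, FiniteField.X_pow_card_sub_X_natDegree_eq F hc]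
    rfl
  rw [FiniteField.roots_X_pow_card_sub_X] at h2
  have h3 : eval z (X ^ Fintype.card F - X : K[X]) = 0 := by simp [h]
  rw [e, h2, eval_map] at h3
  have h4 : ∏ a : F, (z - φ a) = 0 := by
    change eval₂ φ z (∏ a : F, (X - C a)) = 0 at h3
    simpa [eval₂_finsetProd] using h3
  obtain ⟨a, -, ha⟩ := Finset.prod_eq_zero_iff.1 h4
  exact ⟨a, (sub_eq_zero.1 ha).symm⟩

/-- A primitive `2 m`-th root of unity `u` that lies in `F`, or is conjugate to its inverse over
`F`, gives an element of order `m`: the matrix with eigenvalues `u` and `u⁻¹`. -/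
lemma exists_orderOf_eq_and_isEigenRatio [Finite F] [IsAlgClosed K] (p : ℕ) [Fact p.Prime]
    [CharP F p] {m : ℕ} (hm0 : 0 < m) (hm : m.Coprime p) {u : K}
    (hu : IsPrimitiveRoot u (2 * m)) (h0 : u ≠ 0)
    (hq : u ^ Nat.card F = u ∨ u ^ Nat.card F = u⁻¹) [CharP K p] :
    ∃ (h : PSL(2, F)) (ω : K), orderOf h = m ∧ IsPrimitiveRoot ω m ∧ IsEigenRatio φ h ω := by
  obtain ⟨n, hn⟩ : ∃ n : ℕ, Nat.card F = p ^ n := by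
    have := Fintype.ofFinite F
    obtain ⟨n, -, hn⟩ := FiniteField.card F p
    exact ⟨n, by rw [Nat.card_eq_fintype_card, hn]⟩
  obtain ⟨τ, hτ⟩ : ∃ τ, φ τ = u + u⁻¹ := by
    apply mem_range_of_pow_card
    rw [hn, add_pow_char_pow, ← hn, inv_pow]
    rcases hq with h | h <;> rw [h]
    rw [inv_inv, add_comm]
  let x : PSL(2, F) := (companion τ : SL(2, F))
  have hx : IsEigenRatio φ x (u ^ 2) := by
    refine ⟨pow_ne_zero _ h0, companion τ, rfl, ?_⟩
    have : (companion τ).1.trace = τ := by simp [companion, trace_fin_two]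
    rw [this, hτ]
    field_simp
    ring
  have hω : IsPrimitiveRoot (u ^ 2) m := by
    exact hu.pow (by positivity) rfl
  have hωp : IsPrimitiveRoot ((u ^ 2) ^ p) m := hω.pow_of_coprime p hm.symm
  -- The `p`-th power removes a possible factor `p` of the order of `x`, so it need not be shown
  -- that `x` is semisimple.
  refine ⟨x ^ p, (u ^ 2) ^ p, ?_, hωp, hx.pow φ p⟩
  apply Nat.dvd_antisymm
  · apply orderOf_dvd_of_pow_eq_one
    have := hx.pow φ m
    rw [hω.pow_eq_one] at this
    rw [← pow_mul, mul_comm, pow_mul]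
    exact this.pow_char_eq_one φ p
  · have := (hx.pow φ p).pow φ (orderOf (x ^ p))
    rw [pow_orderOf_eq_one] at this
    exact hωp.dvd_of_pow_eq_one _ (this.eq_one φ)

end Ratio

end Matrices

/-! ### Traces of roots of unity -/

lemma isPrimitiveRoot_zeta {n : ℕ} (hn : n ≠ 0) : IsPrimitiveRoot (zeta n) n :=
  Complex.isPrimitiveRoot_exp n hn

lemma cycTrace_of_mem {ζ z : ℂ} (h : z ∈ IntermediateField.adjoin ℚ {ζ}) :
    cycTrace ζ z = Algebra.trace ℚ (IntermediateField.adjoin ℚ {ζ}) ⟨z, h⟩ := by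
  rw [cycTrace, dif_pos h]

lemma cycTrace_add {ζ z w : ℂ} (hz : z ∈ IntermediateField.adjoin ℚ {ζ})
    (hw : w ∈ IntermediateField.adjoin ℚ {ζ}) :
    cycTrace ζ (z + w) = cycTrace ζ z + cycTrace ζ w := by
  rw [cycTrace_of_mem hz, cycTrace_of_mem hw, cycTrace_of_mem (add_mem hz hw), ← map_add]
  rfl

lemma cycTrace_zero (ζ : ℂ) : cycTrace ζ 0 = 0 := by
  rw [cycTrace_of_mem (zero_mem _)]
  exact map_zero _

lemma cycTrace_sum {ι : Type*} (s : Finset ι) {ζ : ℂ} {z : ι → ℂ}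
    (hz : ∀ i ∈ s, z i ∈ IntermediateField.adjoin ℚ {ζ}) :
    cycTrace ζ (∑ i ∈ s, z i) = ∑ i ∈ s, cycTrace ζ (z i) := by
  classical
  induction s using Finset.induction_on with
  | empty => simp [cycTrace_zero]
  | insert a s ha ih =>
    have hs : ∀ i ∈ s, z i ∈ IntermediateField.adjoin ℚ {ζ} := fun i hi =>
      hz i (Finset.mem_insert_of_mem hi)
    rw [Finset.sum_insert ha, Finset.sum_insert ha,
      cycTrace_add (hz a (Finset.mem_insert_self a s)) (sum_mem hs), ih hs]

lemma cycTrace_natCast (ζ : ℂ) (k : ℕ) :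
    cycTrace ζ k = Module.finrank ℚ (IntermediateField.adjoin ℚ {ζ}) * k := by
  rw [cycTrace_of_mem (natCast_mem _ k)]
  have := Algebra.trace_algebraMap (R := ℚ) (S := IntermediateField.adjoin ℚ {ζ}) (k : ℚ)
  rw [nsmul_eq_mul] at this
  rw [← this]
  congr 1

lemma cycTrace_one_natCast (k : ℕ) : cycTrace 1 k = k := by
  rw [cycTrace_natCast, IntermediateField.adjoin_one, IntermediateField.finrank_bot]
  simp

/-- The trace of a nontrivial root of unity of prime order `t` is `-1`, the negative of the
coefficient of `X ^ (t - 2)` in the `t`-th cyclotomic polynomial. -/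
lemma trace_primitiveRoot_prime {t : ℕ} (ht : t.Prime) {L : Type*} [Field L] [Algebra ℚ L]
    [IsCyclotomicExtension {t} ℚ L] {z : L} (hz : IsPrimitiveRoot z t) :
    Algebra.trace ℚ L z = -1 := by
  have := Fact.mk ht
  have : CharZero L := algebraRat.charZero L
  have h := (IsPrimitiveRoot.powerBasis ℚ hz).trace_gen_eq_nextCoeff_minpoly
  rw [IsPrimitiveRoot.powerBasis_gen, ← hz.minpoly_eq_cyclotomic_of_irreducible
    (Polynomial.cyclotomic.irreducible_rat ht.pos), Polynomial.cyclotomic_prime] at h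
  rw [h, neg_inj]
  have hdeg : (∑ i ∈ Finset.range t, (Polynomial.X : Polynomial ℚ) ^ i).natDegree = t - 1 := by
    rw [← Polynomial.cyclotomic_prime ℚ t, Polynomial.natDegree_cyclotomic, Nat.totient_prime ht]
  have h2 := ht.two_le
  rw [Polynomial.nextCoeff_of_natDegree_pos (by rw [hdeg]; omega), hdeg]
  simp [Polynomial.finsetSum_coeff, Polynomial.coeff_X_pow]
  omega

lemma cycTrace_prime {t : ℕ} (ht : t.Prime) {ζ z : ℂ} (hζ : IsPrimitiveRoot ζ t) (hz : z ^ t = 1) :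
    cycTrace ζ z = t * (if z = 1 then 1 else 0) - 1 := by
  have := Fact.mk ht
  have : NeZero t := ⟨ht.ne_zero⟩
  have hL : IsCyclotomicExtension {t} ℚ (IntermediateField.adjoin ℚ {ζ}) := by
    change IsCyclotomicExtension {t} ℚ (IntermediateField.adjoin ℚ {ζ}).toSubalgebra
    rw [IntermediateField.adjoin_simple_toSubalgebra_of_isAlgebraic
      ((hζ.isIntegral ht.pos).tower_top (A := ℚ)).isAlgebraic]
    exact hζ.adjoin_isCyclotomicExtension ℚ
  split_ifs with h
  · subst h
    have := cycTrace_natCast ζ 1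
    rw [IsCyclotomicExtension.finrank (n := t) _ (Polynomial.cyclotomic.irreducible_rat ht.pos),
      Nat.totient_prime ht, Nat.cast_sub ht.one_lt.le] at this
    simpa using this
  · have hp : IsPrimitiveRoot z t := by
      rw [← orderOf_eq_prime hz h]; exact IsPrimitiveRoot.orderOf z
    obtain ⟨i, -, hi⟩ := hζ.eq_pow_of_pow_eq_one hz
    have hmem : z ∈ IntermediateField.adjoin ℚ {ζ} :=
      hi ▸ pow_mem (IntermediateField.mem_adjoin_simple_self ℚ ζ) i
    rw [cycTrace_of_mem hmem, trace_primitiveRoot_prime ht]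
    · simp
    · exact (IsPrimitiveRoot.coe_submonoidClass_iff 
        (N := IntermediateField.adjoin ℚ {ζ}) (ζ := ⟨z, hmem⟩)).1 hp

/-! ### Multiplicities of powers -/

variable {G : Type*} [Group G]

/-- The element of the conjugacy class `c` at which `classSum` evaluates. -/
noncomputable abbrev classRep (c : ConjClasses G) : G := Quotient.out (s := IsConj.setoid G) c

lemma classSum_eq_sum [Fintype (ConjClasses G)] {M : Type*} [AddCommMonoid M] (f : G → M) :
    classSum f = ∑ c : ConjClasses G, f (classRep c) :=
  finsum_eq_sum_of_fintype _

lemma mk_classRep (c : ConjClasses G) : ConjClasses.mk (classRep c) = c :=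
  Quotient.out_eq (s := IsConj.setoid G) c

lemma isConj_classRep (g : G) : IsConj (classRep (ConjClasses.mk g)) g :=
  Quotient.mk_out (s := IsConj.setoid G) g

lemma sum_inv_pow_eq {n t : ℕ} {ξ : ℂ} (hξ : IsPrimitiveRoot ξ (t * n)) (d : ℕ)
    (ht : t ≠ 0) :
    ∑ j ∈ Finset.range n, (ξ ^ (t * d))⁻¹ ^ j = if n ∣ d then (n : ℂ) else 0 := by
  have h1 : ξ ^ (t * d) = 1 ↔ n ∣ d := by
    rw [hξ.pow_eq_one_iff_dvd, Nat.mul_dvd_mul_iff_left (Nat.pos_of_ne_zero ht)]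
  split_ifs with h
  · simp [h1.2 h]
  · have hne : (ξ ^ (t * d))⁻¹ ≠ 1 := by rw [Ne, inv_eq_one]; exact fun h' => h (h1.1 h')
    rw [geom_sum_eq hne, inv_pow, ← pow_mul, mul_right_comm, pow_mul, hξ.pow_eq_one]
    simp

lemma sum_divisors_ite {m t : ℕ} (hm : m ≠ 0) (ht : t.Prime) (htm : t ∣ m) (f : ℕ → ℚ) :
    ∑ d ∈ m.divisors, (if m / t ∣ d then f d else 0) = f (m / t) + f m := by
  obtain ⟨n, rfl⟩ := htm
  have hn : n ≠ 0 := right_ne_zero_of_mul hm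
  have hn' : n ≠ t * n := fun h => ht.one_lt.ne' (by
    have := Nat.eq_of_mul_eq_mul_right (Nat.pos_of_ne_zero hn) ((one_mul n).trans h)
    exact this.symm)
  rw [Nat.mul_div_cancel_left n ht.pos, ← Finset.sum_filter]
  have : (t * n).divisors.filter (n ∣ ·) = {n, t * n} := by
    ext d
    simp only [Finset.mem_filter, Nat.mem_divisors, Finset.mem_insert, Finset.mem_singleton]
    constructor
    · rintro ⟨⟨h, -⟩, ⟨e, rfl⟩⟩
      rw [mul_comm t n] at h
      rcases (Nat.dvd_prime ht).1 (Nat.dvd_of_mul_dvd_mul_left (Nat.pos_of_ne_zero hn) h) with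
        rfl | rfl
      · simp
      · right; ring
    · rintro (rfl | rfl)
      · exact ⟨⟨dvd_mul_left _ _, hm⟩, dvd_rfl⟩
      · exact ⟨⟨dvd_rfl, hm⟩, dvd_mul_left _ _⟩
  rw [this, Finset.sum_pair hn']

/-- The multiplicities at the exponents `l' ≡ l` modulo the prime `t` sum up to a multiplicity of
order `t`: only the components of `pa` at `m / t` and `m` survive. For the partial augmentations of
the powers of a unit `u` this is the passage from `u` to `u ^ (m / t)`. -/
lemma sum_mult_eq [Finite G] {m t : ℕ} (hm : m ≠ 0) (ht : t.Prime) (htm : t ∣ m)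
    (pa : ℕ → G → ℤ) (χ : G → ℂ)
    (hχ : ∀ d ∈ m.divisors, ∀ x, pa d x ≠ 0 → χ x ∈ IntermediateField.adjoin ℚ {zeta m ^ d})
    (l : ℤ) :
    ∑ j ∈ Finset.range (m / t), mult m pa χ (l + t * (j : ℤ)) =
      1 / t * (classSum (fun x => (pa (m / t) x : ℚ) *
          cycTrace (zeta m ^ (m / t)) (χ x * zeta m ^ (-(l * ((m / t : ℕ) : ℤ))))) +
        classSum (fun x => (pa m x : ℚ) *
          cycTrace (zeta m ^ m) (χ x * zeta m ^ (-(l * (m : ℤ)))))) := by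
  have := Fintype.ofFinite (ConjClasses G)
  have hζ := isPrimitiveRoot_zeta hm
  have hζ0 : zeta m ≠ 0 := hζ.ne_zero hm
  have hmt : t * (m / t) = m := Nat.mul_div_cancel' htm
  have hn : m / t ≠ 0 := fun h => hm (by rw [← hmt, h, mul_zero])
  have key : ∀ x : G, ∀ d ∈ m.divisors,
      ∑ j ∈ Finset.range (m / t), (pa d x : ℚ) *
        cycTrace (zeta m ^ d) (χ x * zeta m ^ (-((l + t * (j : ℤ)) * (d : ℤ)))) =
      if m / t ∣ d then ((m / t : ℕ) : ℚ) * ((pa d x : ℚ) *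
        cycTrace (zeta m ^ d) (χ x * zeta m ^ (-(l * (d : ℤ))))) else 0 := by
    intro x d hd
    by_cases hx : pa d x = 0
    · simp [hx]
    have hmem : ∀ l : ℤ, χ x * zeta m ^ (-(l * (d : ℤ))) ∈
        IntermediateField.adjoin ℚ {zeta m ^ d} := by
      intro l
      have : zeta m ^ (-(l * (d : ℤ))) = (zeta m ^ d) ^ (-l) := by
        rw [← zpow_natCast, ← zpow_mul]; congr 1; ring
      rw [this]
      exact mul_mem (hχ d hd x hx) (zpow_mem (IntermediateField.mem_adjoin_simple_self ℚ _) _)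
    rw [← Finset.mul_sum, ← cycTrace_sum _ (fun j _ => hmem _)]
    have e : ∀ j : ℕ, χ x * zeta m ^ (-((l + t * (j : ℤ)) * (d : ℤ))) =
        χ x * zeta m ^ (-(l * (d : ℤ))) * (zeta m ^ (t * d))⁻¹ ^ j := by
      intro j
      rw [mul_assoc, ← zpow_natCast (zeta m), ← zpow_neg, ← zpow_natCast _ j, ← zpow_mul,
        ← zpow_add₀ hζ0]
      congr 2
      push_cast
      ring
    rw [Finset.sum_congr rfl fun j _ => e j, ← Finset.mul_sum,
      sum_inv_pow_eq (by rw [hmt]; exact hζ) d ht.ne_zero]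
    split_ifs with h
    · have : χ x * zeta m ^ (-(l * (d : ℤ))) * ((m / t : ℕ) : ℂ) =
          ∑ _j ∈ Finset.range (m / t), χ x * zeta m ^ (-(l * (d : ℤ))) := by
        rw [Finset.sum_const, Finset.card_range, nsmul_eq_mul, mul_comm]
      rw [this, cycTrace_sum _ (fun j _ => hmem _), Finset.sum_const, Finset.card_range,
        nsmul_eq_mul]
      ring
    · rw [mul_zero, cycTrace_zero, mul_zero]
  simp only [mult, classSum_eq_sum]
  rw [← Finset.mul_sum, Finset.sum_comm, ← Finset.sum_add_distrib]
  have e2 : ∀ c : ConjClasses G, ∑ j ∈ Finset.range (m / t), ∑ d ∈ m.divisors,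
      (pa d (classRep c) : ℚ) * cycTrace (zeta m ^ d)
        (χ (classRep c) *
          zeta m ^ (-((l + t * (j : ℤ)) * (d : ℤ)))) =
      _ := fun c => by
    rw [Finset.sum_comm, Finset.sum_congr rfl (key _), sum_divisors_ite hm ht htm]
  rw [Finset.sum_congr rfl fun c _ => e2 c]
  simp only [← mul_add]
  rw [← Finset.mul_sum, ← mul_assoc]
  congr 1
  have h1 : (m : ℚ) = t * ((m / t : ℕ) : ℚ) := by exact_mod_cast hmt.symm
  have h2 : ((m / t : ℕ) : ℚ) ≠ 0 := by exact_mod_cast hn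
  have h3 : (t : ℚ) ≠ 0 := by exact_mod_cast ht.ne_zero
  rw [h1]
  field_simp

/-! ### Concentration on one class at a prime -/

lemma cycTrace_one_add_add_mul {t : ℕ} (ht : t.Prime) {ζ e ξ : ℂ} (hζ : IsPrimitiveRoot ζ t)
    (he : e ^ t = 1) (hξ : ξ ^ t = 1) (hξ1 : ξ ≠ 1) :
    cycTrace ζ ((1 + e + e⁻¹) * ξ⁻¹) =
      t * ((if e = ξ then 1 else 0) + (if e⁻¹ = ξ then 1 else 0)) - 3 := by
  have : NeZero t := ⟨ht.ne_zero⟩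
  have hmem : ∀ z : ℂ, z ^ t = 1 → z ∈ IntermediateField.adjoin ℚ {ζ} := by
    intro z hz
    obtain ⟨i, -, rfl⟩ := hζ.eq_pow_of_pow_eq_one hz
    exact pow_mem (IntermediateField.mem_adjoin_simple_self ℚ ζ) i
  have hξ0 : ξ ≠ 0 := by rintro rfl; simp [ht.ne_zero] at hξ
  have h1 : (ξ⁻¹) ^ t = 1 := by rw [inv_pow, hξ, inv_one]
  have h2 : (e * ξ⁻¹) ^ t = 1 := by rw [mul_pow, he, h1, one_mul]
  have h3 : (e⁻¹ * ξ⁻¹) ^ t = 1 := by rw [mul_pow, inv_pow, he, h1, inv_one, one_mul]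
  rw [add_mul, add_mul, one_mul, cycTrace_add (add_mem (hmem _ h1) (hmem _ h2)) (hmem _ h3),
    cycTrace_add (hmem _ h1) (hmem _ h2), cycTrace_prime ht hζ h1, cycTrace_prime ht hζ h2,
    cycTrace_prime ht hζ h3]
  simp only [inv_eq_one, hξ1, mul_inv_eq_one₀ hξ0, if_false]
  ring

/-- Let `χ` be a class function, with nonnegative multiplicities, whose value at each `x` of order
dividing `m` is `1 + e x + (e x)⁻¹` for a root of unity `e x` of the same order as `x`. The
multiplicity of `ξ ≠ 1` in order `t` is then the sum of the partial augmentations at the `x` of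
order `t` with `e x = ξ` or `(e x)⁻¹ = ξ`. When these form one class, all partial augmentations
`pa (m / t)` are nonnegative; having sum `1` they are concentrated on one class. -/
lemma IsVPA.exists_isConj_iff [Finite G] {m t : ℕ} (hm : m ≠ 0) (ht : t.Prime) (htm : t ∣ m)
    {pa : ℕ → G → ℤ} (hpa : IsVPA m pa) {χ : G → ℂ} (hχ : ∀ l : ℤ, ∃ k : ℕ, mult m pa χ l = k)
    (e : G → ℂ) (hχe : ∀ x, orderOf x ∣ m → χ x = 1 + e x + (e x)⁻¹)
    (he : ∀ x, orderOf x ∣ m → ∀ k : ℕ, x ^ k = 1 ↔ e x ^ k = 1)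
    (hsep : ∀ x y, orderOf x = t → orderOf y = t → (e x = e y ∨ (e x)⁻¹ = e y) → IsConj x y) :
    ∃ x₀ : G, orderOf x₀ = t ∧
      ∀ g, (IsConj x₀ g → pa (m / t) g = 1) ∧ (¬ IsConj x₀ g → pa (m / t) g = 0) := by
  have := Fintype.ofFinite (ConjClasses G)
  have hζ := isPrimitiveRoot_zeta hm
  have hmt : t * (m / t) = m := Nat.mul_div_cancel' htm
  have hn : m / t ≠ 0 := fun h => hm (by rw [← hmt, h, mul_zero])
  have hζt : IsPrimitiveRoot (zeta m ^ (m / t)) t :=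
    hζ.pow (Nat.pos_of_ne_zero hm) (Nat.div_mul_cancel htm).symm
  have : NeZero t := ⟨ht.ne_zero⟩
  have hndiv : m / t ∈ m.divisors := Nat.mem_divisors.2 ⟨Nat.div_dvd_of_dvd htm, hm⟩
  have hmdiv : m ∈ m.divisors := Nat.mem_divisors.2 ⟨dvd_rfl, hm⟩
  have hnm : m / t ≠ m := (Nat.div_lt_self (Nat.pos_of_ne_zero hm) ht.one_lt).ne
  have hcl := hpa.classFunction _ hndiv
  have hsupp : ∀ d ∈ m.divisors, ∀ x, pa d x ≠ 0 → orderOf x ∣ m / d := fun d hd x hx =>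
    not_not.1 fun h => hx (hpa.v3 d hd x h)
  have horder : ∀ x, pa (m / t) x ≠ 0 → orderOf x = t := by
    intro x hx
    have h := hsupp _ hndiv x hx
    rw [Nat.div_div_self htm hm] at h
    refine ((Nat.dvd_prime ht).1 h).resolve_left fun h1 => hx ?_
    rw [orderOf_eq_one_iff.1 h1]
    exact hpa.v2 _ hndiv hnm
  have hfield : ∀ d ∈ m.divisors, ∀ x, pa d x ≠ 0 →
      χ x ∈ IntermediateField.adjoin ℚ {zeta m ^ d} := by
    intro d hd x hx
    have hdm := (Nat.mem_divisors.1 hd).1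
    have hox := hsupp d hd x hx
    have hoxm : orderOf x ∣ m := hox.trans (Nat.div_dvd_of_dvd hdm)
    have hpow : e x ^ (m / d) = 1 := (he x hoxm _).1 (orderOf_dvd_iff_pow_eq_one.1 hox)
    have hprim : IsPrimitiveRoot (zeta m ^ d) (m / d) :=
      hζ.pow (Nat.pos_of_ne_zero hm) (Nat.mul_div_cancel' hdm).symm
    have : NeZero (m / d) := ⟨(Nat.div_pos (Nat.le_of_dvd (Nat.pos_of_ne_zero hm) hdm)
      (Nat.pos_of_mem_divisors hd)).ne'⟩
    obtain ⟨i, -, hi⟩ := hprim.eq_pow_of_pow_eq_one hpow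
    have hex : e x ∈ IntermediateField.adjoin ℚ {zeta m ^ d} :=
      hi ▸ pow_mem (IntermediateField.mem_adjoin_simple_self ℚ _) i
    rw [hχe x hoxm]
    exact add_mem (add_mem (one_mem _) hex) (inv_mem hex)
  have hdvd : ∀ x : G, orderOf x = t → orderOf x ∣ m := fun x hx => hx ▸ htm
  have het : ∀ x : G, orderOf x = t → e x ^ t = 1 := fun x hx =>
    (he x (hdvd x hx) t).1 (by rw [← hx]; exact pow_orderOf_eq_one x)
  have he1 : ∀ x : G, orderOf x = t → e x ≠ 1 := fun x hx h1 => by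
    have := (he x (hdvd x hx) 1).2 (by rw [pow_one, h1])
    rw [pow_one] at this
    rw [this, orderOf_one] at hx
    exact ht.one_lt.ne hx
  -- `ξ` runs over the nontrivial `t`-th roots of unity; the sum below is its multiplicity.
  have hnonneg : ∀ ξ : ℂ, ξ ^ t = 1 → ξ ≠ 1 → (0 : ℚ) ≤ ∑ c : ConjClasses G,
      (pa (m / t) (classRep c) : ℚ) *
        ((if e (classRep c) = ξ then 1 else 0) +
          (if (e (classRep c))⁻¹ = ξ then 1 else 0)) := by
    intro ξ hξ hξ1
    obtain ⟨l, -, hl⟩ := hζt.eq_pow_of_pow_eq_one hξ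
    have h0 : (0 : ℚ) ≤ ∑ j ∈ Finset.range (m / t), mult m pa χ (l + t * (j : ℤ)) :=
      Finset.sum_nonneg fun j _ => by
        obtain ⟨k, hk⟩ := hχ (l + t * (j : ℤ))
        rw [hk]
        exact Nat.cast_nonneg k
    rw [sum_mult_eq hm ht htm pa χ hfield] at h0
    -- The component at `m` lives on the identity, so it contributes the degree `3`, which cancels
    -- the constant `-3` in the contribution of the component at `m / t`.
    have hSm : classSum (fun x => (pa m x : ℚ) *
        cycTrace (zeta m ^ m) (χ x * zeta m ^ (-((l : ℤ) * (m : ℤ))))) = 3 := by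
      have hv := hpa.v1 m hmdiv
      rw [classSum_eq_sum] at hv ⊢
      have : ∀ x : G, (pa m x : ℚ) *
          cycTrace (zeta m ^ m) (χ x * zeta m ^ (-((l : ℤ) * (m : ℤ)))) = (pa m x : ℚ) * 3 := by
        intro x
        by_cases hx : pa m x = 0
        · simp [hx]
        have hox := hsupp m hmdiv x hx
        rw [Nat.div_self (Nat.pos_of_ne_zero hm), Nat.dvd_one] at hox
        have hx1 : e x = 1 := by
          have := (he x (hox ▸ one_dvd m) 1).1 (by rw [pow_one]; exact orderOf_eq_one_iff.1 hox)
          rwa [pow_one] at this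
        have hz : zeta m ^ (-((l : ℤ) * (m : ℤ))) = 1 := by
          rw [mul_comm, ← mul_neg, zpow_mul, zpow_natCast, hζ.pow_eq_one, one_zpow]
        have h3 : (1 + 1 + 1⁻¹ : ℂ) * 1 = ((3 : ℕ) : ℂ) := by norm_num
        rw [hχe x (hox ▸ one_dvd m), hx1, hz, hζ.pow_eq_one, h3, cycTrace_one_natCast]
        norm_num
      rw [Finset.sum_congr rfl fun c _ => this _, ← Finset.sum_mul]
      have hv' : (∑ c : ConjClasses G,
        (pa m (classRep c) : ℚ)) = 1 := by exact_mod_cast hv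
      rw [hv', one_mul]
    have hSn : classSum (fun x => (pa (m / t) x : ℚ) *
        cycTrace (zeta m ^ (m / t)) (χ x * zeta m ^ (-((l : ℤ) * ((m / t : ℕ) : ℤ))))) =
        t * (∑ c : ConjClasses G,
      (pa (m / t) (classRep c) : ℚ) *
        ((if e (classRep c) = ξ then 1 else 0) +
          (if (e (classRep c))⁻¹ = ξ then 1 else 0))) - 3 := by
      have hv := hpa.v1 _ hndiv
      rw [classSum_eq_sum] at hv ⊢
      have : ∀ x : G, (pa (m / t) x : ℚ) *
          cycTrace (zeta m ^ (m / t)) (χ x * zeta m ^ (-((l : ℤ) * ((m / t : ℕ) : ℤ)))) =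
          t * ((pa (m / t) x : ℚ) * ((if e x = ξ then 1 else 0) +
            (if (e x)⁻¹ = ξ then 1 else 0))) - (pa (m / t) x : ℚ) * 3 := by
        intro x
        by_cases hx : pa (m / t) x = 0
        · simp [hx]
        have hox := horder x hx
        have hz : zeta m ^ (-((l : ℤ) * ((m / t : ℕ) : ℤ))) = ξ⁻¹ := by
          rw [← hl, ← pow_mul, mul_comm (m / t), zpow_neg, ← Nat.cast_mul, zpow_natCast]
        rw [hχe x (hdvd x hox), hz, cycTrace_one_add_add_mul ht hζt (het x hox) hξ hξ1]
        ring
      rw [Finset.sum_congr rfl fun c _ => this _, Finset.sum_sub_distrib, ← Finset.mul_sum,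
        ← Finset.sum_mul]
      have hv' : (∑ c : ConjClasses G,
        (pa (m / t) (classRep c) : ℚ)) = 1 := by exact_mod_cast hv
      rw [hv', one_mul]
    rw [hSm, hSn, sub_add_cancel, ← mul_assoc, one_div_mul_cancel
      (by exact_mod_cast ht.ne_zero), one_mul] at h0
    exact h0
  -- For `ξ = e x` with `x` in the class `c`, only the summand at `c` is nonzero.
  have hpos : ∀ c : ConjClasses G, 0 ≤ pa (m / t) (classRep c) := by
    intro c
    by_cases hc : pa (m / t) (classRep c) = 0
    · exact hc.ge
    have hoc := horder _ hc
    have h := hnonneg _ (het _ hoc) (he1 _ hoc)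
    rw [Finset.sum_eq_single c] at h
    · rw [if_pos rfl] at h
      have hp : (0 : ℚ) < 1 + (if (e (classRep c))⁻¹ =
          e (classRep c) then 1 else 0) := by
        split_ifs <;> norm_num
      exact_mod_cast nonneg_of_mul_nonneg_left h hp
    · intro c' _ hne
      by_cases hc' : pa (m / t) (classRep c') = 0
      · simp [hc']
      have hnc : ¬ IsConj (classRep c')
          (classRep c) := fun h => hne
        ((mk_classRep c').symm.trans ((ConjClasses.mk_eq_mk_iff_isConj.2 h).trans (mk_classRep c)))
      rw [if_neg fun h => hnc (hsep _ _ (horder _ hc') hoc (Or.inl h)),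
        if_neg fun h => hnc (hsep _ _ (horder _ hc') hoc (Or.inr h))]
      simp
    · simp
  have hsum := hpa.v1 _ hndiv
  rw [classSum_eq_sum] at hsum
  obtain ⟨c₀, -, hc₀⟩ : ∃ c ∈ (Finset.univ : Finset (ConjClasses G)),
      pa (m / t) (classRep c) ≠ 0 :=
    Finset.exists_ne_zero_of_sum_ne_zero (by rw [hsum]; norm_num)
  classical
  rw [← Finset.add_sum_erase _ _ (Finset.mem_univ c₀)] at hsum
  have hrest : 0 ≤ ∑ c ∈ Finset.univ.erase c₀,
      pa (m / t) (classRep c) := Finset.sum_nonneg fun c _ => hpos c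
  have h0 := hpos c₀
  have hone : pa (m / t) (classRep c₀) = 1 := by omega
  have hzero : ∑ c ∈ Finset.univ.erase c₀,
      pa (m / t) (classRep c) = 0 := by omega
  rw [Finset.sum_eq_zero_iff_of_nonneg fun c _ => hpos c] at hzero
  refine ⟨classRep c₀, horder _ hc₀, fun g => ⟨fun h => ?_, fun h => ?_⟩⟩
  · rw [← hcl _ _ h, hone]
  · rw [← hcl _ _ (isConj_classRep g)]
    refine hzero _ (Finset.mem_erase.2 ⟨fun h' => h ?_, Finset.mem_univ _⟩)
    rw [← h']
    exact isConj_classRep g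

/-! ### Lifting roots of unity to `ℂ` -/

section BrauerCharacter

lemma liftRoot_coe {K : Type*} [Field K] {N : ℕ} (θ : rootsOfUnity N K ≃* rootsOfUnity N ℂ)
    (u : rootsOfUnity N K) : liftRoot θ ((u : Kˣ) : K) = ((θ u : ℂˣ) : ℂ) := by
  have h : ∃ v : rootsOfUnity N K, ((v : Kˣ) : K) = ((u : Kˣ) : K) := ⟨u, rfl⟩
  rw [liftRoot, dif_pos h]
  have : h.choose = u := Subtype.ext (Units.ext h.choose_spec)
  rw [this]

variable {K : Type*} [Field K] {N : ℕ} (θ : rootsOfUnity N K ≃* rootsOfUnity N ℂ)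

lemma exists_coe_rootsOfUnity {z : K} (hN : N ≠ 0) (hz : z ^ N = 1) :
    ∃ u : rootsOfUnity N K, ((u : Kˣ) : K) = z :=
  have : NeZero N := ⟨hN⟩
  ⟨rootsOfUnity.mkOfPowEq z hz, rfl⟩

lemma liftRoot_one : liftRoot θ 1 = 1 := by
  simpa using liftRoot_coe θ 1

lemma liftRoot_inv {z : K} (hN : N ≠ 0) (hz : z ^ N = 1) : liftRoot θ z⁻¹ = (liftRoot θ z)⁻¹ := by
  obtain ⟨u, rfl⟩ := exists_coe_rootsOfUnity hN hz
  have := liftRoot_coe θ u⁻¹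
  rw [map_inv] at this
  rw [liftRoot_coe]
  simpa using this

lemma liftRoot_pow_eq_one_iff {z : K} (hN : N ≠ 0) (hz : z ^ N = 1) (k : ℕ) :
    liftRoot θ z ^ k = 1 ↔ z ^ k = 1 := by
  obtain ⟨u, rfl⟩ := exists_coe_rootsOfUnity hN hz
  rw [liftRoot_coe]
  have h1 : ((u : Kˣ) : K) ^ k = 1 ↔ u ^ k = 1 := by
    rw [← Units.val_pow_eq_pow_val, Units.val_eq_one, ← Subgroup.coe_pow, OneMemClass.coe_eq_one]
  have h2 : ((θ u : ℂˣ) : ℂ) ^ k = 1 ↔ θ u ^ k = 1 := by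
    rw [← Units.val_pow_eq_pow_val, Units.val_eq_one, ← Subgroup.coe_pow, OneMemClass.coe_eq_one]
  rw [h1, h2, ← map_pow, map_eq_one_iff θ θ.injective]

lemma liftRoot_injOn (hN : N ≠ 0) {z w : K} (hz : z ^ N = 1) (hw : w ^ N = 1)
    (h : liftRoot θ z = liftRoot θ w) : z = w := by
  obtain ⟨u, rfl⟩ := exists_coe_rootsOfUnity hN hz
  obtain ⟨v, rfl⟩ := exists_coe_rootsOfUnity hN hw
  rw [liftRoot_coe, liftRoot_coe] at h
  rw [θ.injective (Subtype.ext (Units.ext h))]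

end BrauerCharacter

/-! ### Regular elements and their roots of unity -/

lemma regularPart_ne_zero (G : Type*) [Group G] [Finite G] (p : ℕ) : regularPart G p ≠ 0 :=
  (Nat.ordCompl_pos p Nat.card_pos.ne').ne'

lemma orderOf_dvd_regularPart [Finite G] {p : ℕ} (hp : p.Prime) {x : G} (hx : ¬ p ∣ orderOf x) :
    orderOf x ∣ regularPart G p := by
  have h1 : orderOf x ∣ p ^ (Nat.card G).factorization p * regularPart G p := by
    rw [regularPart, Nat.ordProj_mul_ordCompl_eq_self]
    exact orderOf_dvd_natCard x
  exact (((hp.coprime_iff_not_dvd.2 hx).symm).pow_right _).dvd_of_dvd_mul_left h1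

lemma exists_rootsOfUnity_equiv (p : ℕ) [Fact p.Prime] {N : ℕ} (hN : ¬ p ∣ N) (hN0 : N ≠ 0) :
    Nonempty (rootsOfUnity N (AlgebraicClosure (ZMod p)) ≃* rootsOfUnity N ℂ) := by
  have : NeZero N := ⟨hN0⟩
  have : NeZero (N : AlgebraicClosure (ZMod p)) :=
    ⟨fun h => hN ((CharP.cast_eq_zero_iff (AlgebraicClosure (ZMod p)) p N).1 h)⟩
  exact ⟨mulEquivOfCyclicCardEq (by
    rw [HasEnoughRootsOfUnity.natCard_rootsOfUnity, HasEnoughRootsOfUnity.natCard_rootsOfUnity])⟩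

end HeLP

/-! ### The distribution at the prime divisors of the order -/

open HeLP in
theorem corollary4p3 {F : Type*} [Field F] [Finite F] (q : ℕ) (hF : Nat.card F = q)
    (hq : Odd q) (m : ℕ) (hm : Squarefree m)
    (hqm : (q : ℤ) ≡ 1 [ZMOD 2 * (m : ℤ)] ∨ (q : ℤ) ≡ -1 [ZMOD 2 * (m : ℤ)])
    (pa : ℕ → PSL(2, F) → ℤ) (hpa : HeLP.IsVPA m pa) :
    ∃ g₀ : PSL(2, F), orderOf g₀ = m ∧
      ∀ t : ℕ, t.Prime → t ∣ m → ∀ g : PSL(2, F),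
        (IsConj (g₀ ^ (m / t)) g → pa (m / t) g = 1) ∧
        (¬ IsConj (g₀ ^ (m / t)) g → pa (m / t) g = 0) := by
  have hm0 : m ≠ 0 := hm.ne_zero
  obtain ⟨p, hcharF⟩ := CharP.exists F
  have hp : p.Prime := CharP.char_is_prime F p
  have := Fact.mk hp
  have hpq : p ∣ q := by
    rw [← hF]
    have := Fintype.ofFinite F
    obtain ⟨n, -, hn⟩ := FiniteField.card F p
    rw [Nat.card_eq_fintype_card, hn]
    exact dvd_pow_self p n.ne_zero
  -- A prime dividing both `q` and `2 m` would divide `1`.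
  have hp2m : ¬ p ∣ 2 * m := by
    intro h
    have h1 : (p : ℤ) ∣ 2 * (m : ℤ) := by exact_mod_cast h
    have h2 : (p : ℤ) ∣ q := by exact_mod_cast hpq
    have h3 : ¬ (p : ℤ) ∣ 1 := (Nat.prime_iff_prime_int.1 hp).not_dvd_one
    rcases hqm with hc | hc
    · have := h1.trans hc.dvd
      exact h3 ((dvd_sub_left h2).1 this)
    · have := h1.trans hc.dvd
      exact h3 (by simpa using (dvd_sub_left h2).1 this)
  have hpm : ¬ p ∣ m := fun h => hp2m (h.mul_left 2)
  have hcop : m.Coprime p := (hp.coprime_iff_not_dvd.2 hpm).symm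
  let K := AlgebraicClosure (ZMod p)
  have : Infinite K := IsAlgClosed.instInfinite
  algebraize [ZMod.castHom (dvd_refl p) F]
  let φ : F →+* K := (IsAlgClosed.lift : F →ₐ[ZMod p] K).toRingHom
  let N := regularPart PSL(2, F) p
  have hN0 : N ≠ 0 := regularPart_ne_zero _ p
  obtain ⟨θ⟩ := exists_rootsOfUnity_equiv p (N := N)
    (Nat.not_dvd_ordCompl hp Nat.card_pos.ne') hN0
  choose ω hω using exists_isEigenRatio (K := K) φ
  have hreg : ∀ x : PSL(2, F), ¬ p ∣ orderOf x → ∀ k, x ^ k = 1 ↔ ω x ^ k = 1 := fun x hx k =>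
    (hω x).pow_eq_one_iff φ p (hp.coprime_iff_not_dvd.2 hx).symm k
  have hωN : ∀ x : PSL(2, F), ¬ p ∣ orderOf x → ω x ^ N = 1 := fun x hx =>
    (hreg x hx N).1 (orderOf_dvd_iff_pow_eq_one.1 (orderOf_dvd_regularPart hp hx))
  have hdvd : ∀ x : PSL(2, F), orderOf x ∣ m → ¬ p ∣ orderOf x := fun x hx h => hpm (h.trans hx)
  -- The Brauer character of the symmetric square.
  let χ : PSL(2, F) → ℂ := fun g => if p ∣ orderOf g then 0 else
    (((symSqRep φ) g).charpoly.roots.map (liftRoot θ)).sum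
  have hχ : IsBrauerCharacter p χ :=
    ⟨θ, 3, symSqRep φ, fun g hg => if_neg hg, fun g hg => if_pos hg⟩
  have hχval : ∀ x, orderOf x ∣ m → χ x = 1 + liftRoot θ (ω x) + (liftRoot θ (ω x))⁻¹ := by
    intro x hx
    change (if _ then _ else _) = _
    rw [if_neg (hdvd x hx), roots_charpoly_symSqRep φ (hω x)]
    simp only [Multiset.insert_eq_cons, Multiset.map_cons, Multiset.map_singleton,
      Multiset.sum_cons, Multiset.sum_singleton]
    rw [liftRoot_one, liftRoot_inv θ hN0 (hωN x (hdvd x hx)), add_assoc]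
  have hodd : Odd (Nat.card F) := hF ▸ hq
  -- For each prime `t` dividing `m`, `pa (m / t)` is concentrated on one class.
  have hclass : ∀ t : ℕ, t.Prime → t ∣ m → ∃ x₀ : PSL(2, F), orderOf x₀ = t ∧
      ∀ g, (IsConj x₀ g → pa (m / t) g = 1) ∧ (¬ IsConj x₀ g → pa (m / t) g = 0) := by
    intro t ht htm
    refine hpa.exists_isConj_iff hm0 ht htm (hpa.v4_brauer p hpm χ hχ)
      (fun x => liftRoot θ (ω x)) hχval ?_ ?_
    · intro x hx k
      rw [liftRoot_pow_eq_one_iff θ hN0 (hωN x (hdvd x hx)), hreg x (hdvd x hx)]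
    · intro x y hx hy h
      have hx' := hdvd x (hx ▸ htm)
      have hy' := hdvd y (hy ▸ htm)
      have hy1 : ω y ≠ 1 := fun h1 => by
        have := (hreg y hy' 1).2 (by rw [h1, one_pow])
        rw [pow_one] at this
        rw [this, orderOf_one] at hy
        exact ht.one_lt.ne hy
      rcases h with h | h
      · have := liftRoot_injOn θ hN0 (hωN x hx') (hωN y hy') h
        exact (this ▸ hω x : IsEigenRatio φ x (ω y)).isConj φ hodd (hω y) hy1
      · rw [← liftRoot_inv θ hN0 (hωN x hx')] at h
        have := liftRoot_injOn θ hN0 (by rw [inv_pow, hωN x hx', inv_one]) (hωN y hy') h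
        exact (this ▸ (hω x).inv φ : IsEigenRatio φ x (ω y)).isConj φ hodd (hω y) hy1
  -- A cyclic subgroup of order `m`.
  have : NeZero ((2 * m : ℕ) : K) := ⟨fun h => hp2m ((CharP.cast_eq_zero_iff K p _).1 h)⟩
  obtain ⟨u, hu⟩ := HasEnoughRootsOfUnity.exists_primitiveRoot K (2 * m)
  have hu0 : u ≠ 0 := hu.ne_zero (by positivity)
  have huq : u ^ Nat.card F = u ∨ u ^ Nat.card F = u⁻¹ := by
    rw [hF, ← zpow_natCast]
    rcases hqm with hc | hc
    · left
      have h1 : u ^ ((q : ℤ) - 1) = 1 :=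
        (hu.zpow_eq_one_iff_dvd _).2 (by push_cast; exact hc.symm.dvd)
      rwa [zpow_sub_one₀ hu0, mul_inv_eq_one₀ hu0] at h1
    · right
      have h1 : u ^ ((q : ℤ) + 1) = 1 :=
        (hu.zpow_eq_one_iff_dvd _).2 (by push_cast; simpa using hc.symm.dvd)
      rw [zpow_add_one₀ hu0] at h1
      exact eq_inv_of_mul_eq_one_left h1
  obtain ⟨h, w, hh, hw, hhw⟩ := exists_orderOf_eq_and_isEigenRatio φ p
    (Nat.pos_of_ne_zero hm0) hcop hu hu0 huq
  -- Each class of elements of order `t` meets this subgroup.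
  have hmeet : ∀ t : ℕ, t.Prime → t ∣ m → ∃ j : ℕ, j.Coprime t ∧
      ∀ b : ℕ, b ≡ j [MOD t] → ∀ g, (IsConj ((h ^ b) ^ (m / t)) g → pa (m / t) g = 1) ∧
        (¬ IsConj ((h ^ b) ^ (m / t)) g → pa (m / t) g = 0) := by
    intro t ht htm
    obtain ⟨x₀, hx₀, hx⟩ := hclass t ht htm
    have hreg₀ := hdvd x₀ (hx₀ ▸ htm)
    have hwt : IsPrimitiveRoot (w ^ (m / t)) t :=
      hw.pow (Nat.pos_of_ne_zero hm0) (Nat.div_mul_cancel htm).symm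
    have : NeZero t := ⟨ht.ne_zero⟩
    obtain ⟨j, -, hj⟩ := hwt.eq_pow_of_pow_eq_one
      ((hreg x₀ hreg₀ t).1 (by rw [← hx₀]; exact pow_orderOf_eq_one x₀))
    have hω1 : ω x₀ ≠ 1 := fun h1 => by
      have := (hreg x₀ hreg₀ 1).2 (by rw [h1, one_pow])
      rw [pow_one] at this
      rw [this, orderOf_one] at hx₀
      exact ht.one_lt.ne hx₀
    refine ⟨j, ?_, fun b hb => ?_⟩
    · rw [Nat.coprime_comm, ht.coprime_iff_not_dvd]
      intro hd
      exact hω1 (by rw [← hj]; exact (hwt.pow_eq_one_iff_dvd j).2 hd)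
    · have hbj : (w ^ (m / t)) ^ b = (w ^ (m / t)) ^ j :=
        pow_eq_pow_of_modEq hb hwt.pow_eq_one
      have hE : IsEigenRatio φ ((h ^ b) ^ (m / t)) (ω x₀) := by
        have := (hhw.pow φ b).pow φ (m / t)
        rwa [← pow_mul w, mul_comm b, pow_mul w, hbj, hj] at this
      have hc := hE.isConj φ hodd (hω x₀) hω1
      exact fun g => ⟨fun hg => (hx g).1 (hc.symm.trans hg),
        fun hg => (hx g).2 fun h' => hg (hc.trans h')⟩
  choose! j hj hjx using hmeet
  let b := Nat.chineseRemainderOfFinset j id m.primeFactors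
    (fun t ht => (Nat.prime_of_mem_primeFactors ht).ne_zero)
    (fun s hs t ht hst => (Nat.coprime_primes (Nat.prime_of_mem_primeFactors hs)
      (Nat.prime_of_mem_primeFactors ht)).2 hst)
  have hb : ∀ t : ℕ, t.Prime → t ∣ m → b.1 ≡ j t [MOD t] := fun t ht htm =>
    b.2 t (Nat.mem_primeFactors.2 ⟨ht, htm, hm0⟩)
  refine ⟨h ^ b.1, ?_, fun t ht htm => hjx t ht htm b.1 (hb t ht htm)⟩
  have hbm : m.Coprime b.1 := Nat.coprime_of_dvd fun t ht htm htb => by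
    have h1 : Nat.gcd (j t) t = 1 := hj t ht htm
    rw [← (hb t ht htm).gcd_eq, Nat.gcd_eq_right htb] at h1
    exact ht.one_lt.ne' h1
  rw [Nat.Coprime.orderOf_pow (by rwa [hh]), hh]
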